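/- Let $f$ be a (real- or complex-valued) real-analytic function at $0$, put $p_f(t)=\frac{e^t-1}{t}f(t)$ (with $p_f(0)=f(0)$), and let $P_{f,n}$ be the coefficients in the expansion $p_f(t)=\sum_{n\ge 0}\frac{P_{f,n}}{n!}t^n$ near $0$. Assume that the power series $\sum_{n\ge 0}P_{f,n}s^n$ has a non-zero radius of convergence $\rho_f\le+\infty$, and put $r_f=1/\rho_f$ (with $r_f=0$ if $\rho_f=+\infty$). Let $\underline f(t)=e^{-t}f(-t)$; then $P_{\underline f,n}=(-1)^nP_{f,n}$, so that $r_{\underline f}=r_f$. For $|s|>r_f$, together with a choice of $\log s$, and for $z\in\mathbb C$ set $$s^{(z,\underline f)}=\sum_{n=0}^{\infty}\binom{z}{n}P_{\underline f,n}\,s^{z-n},\qquad s^{z-n}=e^{(z-n)\log s}.$$ Let $m_f$ be the smallest integer with $r_f<2m_f\pi$, let $r$ be any real number with $r_f<r<2m_f\pi$, and let $\mu_f$ be the Hankel contour that consists of the lower edge $s=te^{-i\pi}$ of the negative real axis ($t$ decreasing from $+\infty$ to $r$), the circle $s=re^{i\theta}$ ($\theta$ increasing from $-\pi$ to $\pi$),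 and the upper edge $s=te^{i\pi}$ ($t$ increasing from $r$ to $+\infty$), where $\log s=\log t-i\pi$, $\log r+i\theta$ and $\log t+i\pi$, respectively. Define $$J(z,\underline f)=\frac{1}{2i\pi}\int_{\mu_f}\frac{s^{(z-1,\underline f)}}{e^{-s}-1}\,ds,\qquad F(z,f)=\Gamma(1-z)\,J(z,\underline f).$$ **Theorem 5.6.** The series defining $s^{(z,\underline f)}$ converges absolutely whenever $|s|>r_f$, the integral defining $J(z,\underline f)$ converges absolutely for every $z\in\mathbb C$, the function $z\mapsto J(z,\underline f)$ is entire, and the FC-function $z\mapsto F(z,f)$ is analytic on $\mathbb C\setminus\{1,2,3,\dots\}$. -/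

import Mathlib

noncomputable section

namespace LCFunctions

open Complex MeasureTheory

/-- `p_f(t) = ((e^t - 1) / t) f(t)`, with the removable singularity at `t = 0` filled in by
`p_f(0) = f(0)`. -/
def pFun (f : ℝ → ℂ) (t : ℝ) : ℂ :=
  if t = 0 then f 0 else (((Real.exp t - 1) / t : ℝ) : ℂ) * f t

/-- The P-numbers `P_{f,n}` associated to `f`: the coefficients in
`p_f(t) = ∑ P_{f,n} t^n / n!`, i.e. the derivatives of `p_f` at `0`. -/
def pNum (f : ℝ → ℂ) (n : ℕ) : ℂ := iteratedDeriv n (pFun f) 0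

/-- `ρ_f ∈ [0, ∞]`: the radius of convergence of the power series `∑ P_{f,n} s^n`. -/
def rho (f : ℝ → ℂ) : ENNReal :=
  (FormalMultilinearSeries.ofScalars ℂ (pNum f)).radius

/-- `r_f = 1 / ρ_f`, with `r_f = 0` when `ρ_f = ∞` (only used when `ρ_f ≠ 0`). -/
def rad (f : ℝ → ℂ) : ℝ := ((rho f)⁻¹).toReal

/-- The function written `f` with an underline: `t ↦ e^{-t} f(-t)`. -/
def under (f : ℝ → ℂ) (t : ℝ) : ℂ := ((Real.exp (-t) : ℝ) : ℂ) * f (-t)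

/-- The `n`-th term `binom(z, n) P_{f,n} s^{z-n}` of the series of `s^{(z,f)}`, at a point `s = e^w`
where the branch of the powers of `s` is the one given by the logarithm `w` of `s`,
i.e. `s^{z-n} = e^{(z-n)w}`. -/
def genPowTerm (f : ℝ → ℂ) (w z : ℂ) (n : ℕ) : ℂ :=
  Ring.choose z n * pNum f n * exp ((z - n) * w)

/-- `s^{(z,f)} = ∑ binom(z, n) P_{f,n} s^{z-n}` at a point `s = e^w`, the branch of the powers of `s`
being given by the logarithm `w` of `s`. Off the negative real axis one takes the principal
logarithm `w = log s`, see `genPow_log`; on the lower and upper edges of the cut `s = -t`, `t > 0`,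
one takes `w = log t - iπ` and `w = log t + iπ`. -/
def genPow (f : ℝ → ℂ) (w z : ℂ) : ℂ := ∑' n : ℕ, genPowTerm f w z n

/-- For the principal logarithm, `genPow` is the series written with Mathlib's complex power. -/
theorem genPow_log (f : ℝ → ℂ) {s : ℂ} (hs : s ≠ 0) (z : ℂ) :
    genPow f (log s) z = ∑' n : ℕ, Ring.choose z n * pNum f n * s ^ (z - n) := by
  simp only [genPow, genPowTerm, cpow_def_of_ne_zero hs, mul_comm (log s)]

/-- The Hankel contour of radius `r` consists of the lower edge `s = t e^{-iπ}` of the negative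
real axis, with `t` decreasing from `+∞` to `r`, of the circle `s = r e^{iθ}`, with `θ` increasing
from `-π` to `π`, and of the upper edge `s = t e^{iπ}`, with `t` increasing from `r` to `+∞`.
This is the integral of `G ds` along it; `G` is a function of the logarithm `w` of `s` (so that the
two edges of the cut are distinguished). On the two edges `ds = -dt`. -/
def hankelIntegral (r : ℝ) (G : ℂ → ℂ) : ℂ :=
  (∫ t in Set.Ioi r, G (Real.log t - Real.pi * I))
  + (∫ θ in (-Real.pi)..Real.pi, G (Real.log r + θ * I) * (I * (r * exp (θ * I))))
  - (∫ t in Set.Ioi r, G (Real.log t + Real.pi * I))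

/-- Absolute convergence of the three integrals making up `hankelIntegral r G`. -/
def HankelIntegrable (r : ℝ) (G : ℂ → ℂ) : Prop :=
  IntegrableOn (fun t : ℝ => G (Real.log t - Real.pi * I)) (Set.Ioi r) ∧
  IntervalIntegrable (fun θ : ℝ => G (Real.log r + θ * I) * (I * (r * exp (θ * I))))
    volume (-Real.pi) Real.pi ∧
  IntegrableOn (fun t : ℝ => G (Real.log t + Real.pi * I)) (Set.Ioi r)

/-- The integrand `s^{(z-1,f)} / (e^{-s} - 1)` of `J(z,f)` at `s = e^w`. -/
def jIntegrand (f : ℝ → ℂ) (z w : ℂ) : ℂ := genPow f w (z - 1) / (exp (-exp w) - 1)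

/-- `J(z,f) = (1 / 2iπ) ∫ s^{(z-1,f)} / (e^{-s} - 1) ds` along the Hankel contour of radius `r`. -/
def J (r : ℝ) (f : ℝ → ℂ) (z : ℂ) : ℂ :=
  1 / (2 * I * Real.pi) * hankelIntegral r (jIntegrand f z)

/-- The FC-function `F(z,f) = Γ(1 - z) J(z, under f)`, with the Hankel contour of radius `r`. -/
def F (r : ℝ) (f : ℝ → ℂ) (z : ℂ) : ℂ := Gamma (1 - z) * J r (under f) z

end LCFunctions

end

namespace LCFunctions

open Complex MeasureTheory Filter Topology

/-! Everything follows from one domination, locally uniform in `z`. For `R > r_f` the P-numbers are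
at most `C * R ^ n`, and passing to `under f` only changes their signs. For `‖z‖ ≤ M + 1` the
binomials grow polynomially in `n` (`norm_choose_le`), so on `|s| ≥ r > R` the series is at most a
constant times `exp ((M + 1) * |log s|)` (`norm_genPow_le`). On the edges this factor loses to the
exponential decay of `1 / (e^t - 1)`; on the circle the kernel is continuous, since no pole has
modulus `r`. Hence each piece of the integral converges absolutely and can be differentiated under
the integral sign, so `J` is entire. Multiplying by `Γ(1 - z)` adds singularities only at its poles.
-/

theorem pFun_under (f : ℝ → ℂ) : pFun (under f) = fun t => pFun f (-t) := by
  funext t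
  by_cases ht : t = 0
  · simp [pFun, under, ht]
  · have h : (Real.exp t - 1) / t * Real.exp (-t) = (Real.exp (-t) - 1) / -t := by
      rw [Real.exp_neg]
      field_simp
      ring
    simp only [pFun, under, ht, neg_eq_zero, if_false]
    rw [← h]
    push_cast
    ring

theorem pNum_under (f : ℝ → ℂ) (n : ℕ) : pNum (under f) n = (-1) ^ n * pNum f n := by
  rw [pNum, pFun_under, iteratedDeriv_comp_neg, pNum, neg_zero, Complex.real_smul]
  push_cast
  rfl

theorem norm_pNum_under (f : ℝ → ℂ) (n : ℕ) : ‖pNum (under f) n‖ = ‖pNum f n‖ := by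
  simp [pNum_under]

theorem rad_nonneg (f : ℝ → ℂ) : 0 ≤ rad f := ENNReal.toReal_nonneg

/-- Cauchy estimate for the P-numbers. -/
theorem exists_norm_pNum_le {f : ℝ → ℂ} (hρ : 0 < rho f) {R : ℝ} (hR : rad f < R) :
    ∃ C, 0 ≤ C ∧ ∀ n, ‖pNum f n‖ ≤ C * R ^ n := by
  have hR0 : 0 < R := (rad_nonneg f).trans_lt hR
  have hlt : ((R⁻¹.toNNReal : NNReal) : ENNReal) <
      (FormalMultilinearSeries.ofScalars ℂ (pNum f)).radius := by
    change ENNReal.ofReal R⁻¹ < rho f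
    rw [ENNReal.ofReal_inv_of_pos hR0, ENNReal.inv_lt_iff_inv_lt]
    exact (ENNReal.lt_ofReal_iff_toReal_lt (ENNReal.inv_ne_top.2 hρ.ne')).2 hR
  obtain ⟨C, hC, h⟩ := FormalMultilinearSeries.norm_mul_pow_le_of_lt_radius _ hlt
  refine ⟨C, hC.le, fun n => ?_⟩
  have := h n
  rw [FormalMultilinearSeries.ofScalars_norm, Real.coe_toNNReal _ (inv_nonneg.2 hR0.le),
    inv_pow] at this
  exact (mul_inv_le_iff₀ (pow_pos hR0 n)).1 this

theorem choose_eq_prod (z : ℂ) (n : ℕ) :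
    Ring.choose z n = (∏ k ∈ Finset.range n, (z - k)) / n.factorial := by
  rw [Ring.choose_eq_smul, ← descPochhammer_eval_eq_prod_range, smul_eq_mul, div_eq_inv_mul,
    ← descPochhammer_map (Int.castRingHom ℂ), ← Polynomial.eval₂_eq_eval_map,
    ← Polynomial.eval₂_smulOneHom_eq_smeval]
  congr 2
  -- There is only one ring homomorphism from `ℤ` to `ℂ`.
  exact Subsingleton.elim _ _

theorem differentiable_choose (n : ℕ) : Differentiable ℂ fun z : ℂ => Ring.choose z n := by
  simp only [choose_eq_prod]
  fun_prop

/-- Factor by factor, `|z - k| ≤ M + 1 + k`, and the product of these bounds over `n!` is the stated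
binomial, polynomial in `n` of degree `M`. -/
theorem norm_choose_le {M : ℕ} {z : ℂ} (hz : ‖z‖ ≤ M + 1) (n : ℕ) :
    ‖Ring.choose z n‖ ≤ ((n + M).choose M : ℝ) := by
  rw [choose_eq_prod, norm_div, norm_prod, Complex.norm_natCast,
    div_le_iff₀ (Nat.cast_pos.2 n.factorial_pos)]
  have h : ((n + M).choose M : ℝ) * n.factorial = ∏ k ∈ Finset.range n, ((M : ℝ) + 1 + k) := by
    have h1 : (n + M).choose M * n.factorial = (M + 1).ascFactorial n := by
      rw [Nat.ascFactorial_eq_factorial_mul_choose, mul_comm, add_comm n M,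
        Nat.choose_symm_add]
    rw [← Nat.cast_mul, h1, Nat.ascFactorial_eq_prod_range]
    push_cast
    rfl
  rw [h]
  refine Finset.prod_le_prod (fun _ _ => norm_nonneg _) fun k _ => ?_
  calc ‖z - k‖ ≤ ‖z‖ + ‖(k : ℂ)‖ := norm_sub_le _ _
    _ ≤ M + 1 + k := by rw [Complex.norm_natCast]; gcongr

theorem summable_choose_mul_pow (M : ℕ) {q : ℝ} (hq0 : 0 ≤ q) (hq : q < 1) :
    Summable fun n : ℕ => ((n + M).choose M : ℝ) * q ^ n :=
  summable_choose_mul_geometric_of_norm_lt_one M (by rwa [Real.norm_of_nonneg hq0])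

/-! ### Bounds and holomorphy for the series of `s^{(z,f)}` -/

section Bounds

variable {f : ℝ → ℂ} {C R r : ℝ}

theorem norm_genPowTerm_le (hC : 0 ≤ C) (hR : 0 ≤ R) (hr : 0 < r)
    (hP : ∀ n, ‖pNum f n‖ ≤ C * R ^ n) {M : ℕ} {z w : ℂ} (hz : ‖z‖ ≤ M + 1)
    (hw : r ≤ ‖exp w‖) (n : ℕ) :
    ‖genPowTerm f w z n‖ ≤
      C * Real.exp ((M + 1) * ‖w‖) * (((n + M).choose M : ℝ) * (R / r) ^ n) := by
  have he : exp ((z - n) * w) = exp (z * w) * (exp w ^ n)⁻¹ := by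
    rw [sub_mul, exp_sub, exp_nat_mul, div_eq_mul_inv]
  have h1 : ‖exp (z * w)‖ ≤ Real.exp ((M + 1) * ‖w‖) := by
    refine (norm_exp_le_exp_norm _).trans (Real.exp_le_exp.2 ?_)
    rw [norm_mul]
    gcongr
  have h2 : ‖(exp w ^ n)⁻¹‖ ≤ (r ^ n)⁻¹ := by
    rw [norm_inv, norm_pow]
    gcongr
  rw [genPowTerm, he, norm_mul, norm_mul, norm_mul]
  calc ‖Ring.choose z n‖ * ‖pNum f n‖ * (‖exp (z * w)‖ * ‖(exp w ^ n)⁻¹‖)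
      ≤ ((n + M).choose M : ℝ) * (C * R ^ n) * (Real.exp ((M + 1) * ‖w‖) * (r ^ n)⁻¹) := by
        gcongr
        · exact norm_choose_le hz n
        · exact hP n
    _ = _ := by rw [div_pow]; ring

theorem summable_genPowTerm (hC : 0 ≤ C) (hR : 0 ≤ R)
    (hP : ∀ n, ‖pNum f n‖ ≤ C * R ^ n) (z : ℂ) {w : ℂ} (hw : R < ‖exp w‖) :
    Summable (genPowTerm f w z) := by
  obtain ⟨M, hM⟩ := exists_nat_ge ‖z‖
  have h0 : 0 < ‖exp w‖ := hR.trans_lt hw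
  exact Summable.of_norm_bounded
    ((summable_choose_mul_pow M (div_nonneg hR h0.le) ((div_lt_one h0).2 hw)).mul_left _)
    (norm_genPowTerm_le hC hR h0 hP (by linarith) le_rfl)

theorem norm_genPow_le (hC : 0 ≤ C) (hR : 0 ≤ R) (hRr : R < r)
    (hP : ∀ n, ‖pNum f n‖ ≤ C * R ^ n) {M : ℕ} {z w : ℂ} (hz : ‖z‖ ≤ M + 1)
    (hw : r ≤ ‖exp w‖) :
    ‖genPow f w z‖ ≤ C * Real.exp ((M + 1) * ‖w‖) *
      ∑' n : ℕ, ((n + M).choose M : ℝ) * (R / r) ^ n := by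
  have h0 : 0 < r := hR.trans_lt hRr
  exact tsum_of_norm_bounded
    ((summable_choose_mul_pow M (div_nonneg hR h0.le) ((div_lt_one h0).2 hRr)).hasSum.mul_left _)
    (norm_genPowTerm_le hC hR h0 hP hz hw)

theorem differentiable_genPow (hC : 0 ≤ C) (hR : 0 ≤ R)
    (hP : ∀ n, ‖pNum f n‖ ≤ C * R ^ n) {w : ℂ} (hw : R < ‖exp w‖) :
    Differentiable ℂ (genPow f w) := by
  intro z₀
  obtain ⟨M, hM⟩ := exists_nat_ge ‖z₀‖
  have h0 : 0 < ‖exp w‖ := hR.trans_lt hw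
  have hd : DifferentiableOn ℂ (genPow f w) (Metric.ball 0 (M + 1)) := by
    refine differentiableOn_tsum_of_summable_norm (F := fun n z => genPowTerm f w z n)
      ((summable_choose_mul_pow M (div_nonneg hR h0.le) ((div_lt_one h0).2 hw)).mul_left
        (C * Real.exp ((M + 1) * ‖w‖)))
      (fun n => ?_) Metric.isOpen_ball fun n z hz => ?_
    · have := differentiable_choose n
      unfold genPowTerm
      fun_prop
    · exact norm_genPowTerm_le hC hR h0 hP (mem_ball_zero_iff.1 hz).le le_rfl n
  exact hd.differentiableAt (Metric.isOpen_ball.mem_nhds (by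
    rw [mem_ball_zero_iff]; linarith))

end Bounds

/-- An integral depending holomorphically on an entire parameter, with locally uniform domination,
is entire. -/
theorem differentiable_integral_of_dominated {α : Type*} [MeasurableSpace α] {μ : Measure α}
    {G : ℂ → α → ℂ} (hmeas : ∀ z, AEStronglyMeasurable (G z) μ)
    (hdiff : ∀ᵐ t ∂μ, Differentiable ℂ fun z => G z t)
    (hb : ∀ K : ℝ, ∃ b : α → ℝ, Integrable b μ ∧ ∀ᵐ t ∂μ, ∀ z, ‖z‖ ≤ K → ‖G z t‖ ≤ b t) :
    Differentiable ℂ fun z => ∫ t, G z t ∂μ := by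
  intro z₀
  -- One unit for `z` in the unit ball about `z₀`, one more for the unit circle about `z` in
  -- Cauchy's estimate of the derivative.
  obtain ⟨b, hbi, hb⟩ := hb (‖z₀‖ + 2)
  have hderiv : AEStronglyMeasurable (fun t => deriv (fun z => G z t) z₀) μ := by
    -- The derivative is measurable in `t` as a limit of difference quotients.
    refine aestronglyMeasurable_of_tendsto_ae (𝓝[≠] (0 : ℂ))
      (f := fun h t => h⁻¹ • (G (z₀ + h) t - G z₀ t))
      (fun h => ((hmeas (z₀ + h)).sub (hmeas z₀)).const_smul h⁻¹) ?_
    filter_upwards [hdiff] with t ht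
    exact (ht z₀).hasDerivAt.tendsto_slope_zero
  refine (hasDerivAt_integral_of_dominated_loc_of_deriv_le (μ := μ) (bound := b)
    (F' := fun z t => deriv (fun z => G z t) z) (Metric.ball_mem_nhds z₀ one_pos)
    (Eventually.of_forall hmeas) ?_ hderiv ?_ hbi ?_).2.differentiableAt
  · refine hbi.mono' (hmeas z₀) ?_
    filter_upwards [hb] with t ht
    exact ht z₀ (by linarith)
  · filter_upwards [hdiff, hb] with t ht hbt z hz
    have := norm_deriv_le_of_forall_mem_sphere_norm_le (c := z) (C := b t) one_pos
      ht.diffContOnCl fun y hy => hbt y ?_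
    · simpa using this
    · rw [mem_sphere_iff_norm] at hy
      rw [mem_ball_iff_norm] at hz
      calc ‖y‖ = ‖z₀ + (z - z₀) + (y - z)‖ := by congr 1; ring
        _ ≤ ‖z₀‖ + ‖z - z₀‖ + ‖y - z‖ := norm_add₃_le
        _ ≤ ‖z₀‖ + 2 := by linarith
  · filter_upwards [hdiff] with t ht z _
    exact (ht z).hasDerivAt

/-- Integrability and holomorphy in `z` of the weighted integral of `s^{(z-1,f)}` along a path
`s = e^{w t}` outside a disc on which the series of `s^{(z,f)}` may diverge. -/
theorem integrable_and_differentiable_integral_genPow {f : ℝ → ℂ} {C R r : ℝ} (hC : 0 ≤ C)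
    (hR : 0 ≤ R) (hRr : R < r) (hP : ∀ n, ‖pNum f n‖ ≤ C * R ^ n) {S : Set ℝ}
    (hS : MeasurableSet S) {w φ : ℝ → ℂ} (hw : Measurable w) (hφ : Measurable φ)
    (hwr : ∀ t ∈ S, r ≤ ‖exp (w t)‖)
    (hint : ∀ K : ℝ, IntegrableOn (fun t => Real.exp (K * ‖w t‖) * ‖φ t‖) S) :
    (∀ z, IntegrableOn (fun t => genPow f (w t) (z - 1) * φ t) S) ∧
      Differentiable ℂ fun z => ∫ t in S, genPow f (w t) (z - 1) * φ t := by
  have hae : ∀ᵐ t ∂volume.restrict S, r ≤ ‖exp (w t)‖ :=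
    (ae_restrict_iff' hS).2 (Eventually.of_forall hwr)
  have hmeas : ∀ z, AEStronglyMeasurable (fun t => genPow f (w t) (z - 1) * φ t)
      (volume.restrict S) := by
    intro z
    refine AEStronglyMeasurable.mul ?_ hφ.aestronglyMeasurable
    refine aestronglyMeasurable_of_tendsto_ae atTop
      (f := fun N t => ∑ n ∈ Finset.range N, genPowTerm f (w t) (z - 1) n) (fun N => ?_) ?_
    · refine Measurable.aestronglyMeasurable (Finset.measurable_fun_sum _ fun n _ => ?_)
      unfold genPowTerm
      fun_prop
    · filter_upwards [hae] with t ht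
      exact (summable_genPowTerm hC hR hP (z - 1)
        (hRr.trans_le ht)).hasSum.tendsto_sum_nat
  have hb : ∀ K : ℝ, ∃ b : ℝ → ℝ, Integrable b (volume.restrict S) ∧
      ∀ᵐ t ∂volume.restrict S, ∀ z, ‖z‖ ≤ K → ‖genPow f (w t) (z - 1) * φ t‖ ≤ b t := by
    intro K
    obtain ⟨M, hM⟩ := exists_nat_ge K
    refine ⟨_, (hint (M + 1)).mul_const
      (C * ∑' n : ℕ, ((n + M).choose M : ℝ) * (R / r) ^ n), ?_⟩
    filter_upwards [hae] with t ht z hz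
    have hz' : ‖z - 1‖ ≤ M + 1 := by
      refine (norm_sub_le _ _).trans ?_
      rw [norm_one]
      linarith
    rw [norm_mul]
    calc _ ≤ _ := mul_le_mul_of_nonneg_right (norm_genPow_le hC hR hRr hP hz' ht) (norm_nonneg _)
      _ = _ := by ring
  refine ⟨fun z => ?_, differentiable_integral_of_dominated hmeas ?_ hb⟩
  · obtain ⟨b, hbi, hb⟩ := hb ‖z‖
    refine hbi.mono' (hmeas z) ?_
    filter_upwards [hb] with t ht
    exact ht z le_rfl
  · filter_upwards [hae] with t ht
    exact ((differentiable_genPow hC hR hP (hRr.trans_le ht)).comp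
      (differentiable_id.sub_const 1)).mul_const _

/-! ### The kernel `1 / (e^{-s} - 1)` on the contour -/

theorem exp_neg_exp_sub_one_ne_zero {w : ℂ} (hw : ∀ n : ℤ, ‖exp w‖ ≠ |(n : ℝ)| * (2 * Real.pi)) :
    exp (-exp w) - 1 ≠ 0 := by
  intro h
  obtain ⟨n, hn⟩ := exp_eq_one_iff.1 (sub_eq_zero.1 h)
  apply hw n
  rw [← norm_neg, hn]
  simp [abs_of_pos Real.pi_pos]

/-- If `r` were the modulus `2π|n|` of a pole, then `ρ < r` and the minimality of `m` would give `m
≤ |n|`, contradicting `r < 2πm`. -/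
theorem ne_abs_mul_two_pi {ρ r : ℝ} {m : ℤ}
    (hm : IsLeast {k : ℤ | ρ < 2 * (k : ℝ) * Real.pi} m) (hr : ρ < r)
    (hr' : r < 2 * (m : ℝ) * Real.pi) (n : ℤ) : r ≠ |(n : ℝ)| * (2 * Real.pi) := by
  rintro rfl
  have h1 : m ≤ |n| := hm.2 (by
    rw [Set.mem_ofPred_eq]
    push_cast
    linarith)
  have h2 : (m : ℝ) ≤ |(n : ℝ)| := by exact_mod_cast h1
  nlinarith [Real.pi_pos]

/-- Since `log t = o(t)`, the first exponent is eventually at most `t / 2`, while the kernel is at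
most `2 * e^{-t}`: half of the decay survives. -/
theorem isBigO_exp_log_div (K : ℝ) (c : ℂ) :
    (fun t : ℝ => Real.exp (K * ‖(Real.log t : ℂ) + c‖) * (Real.exp t - 1)⁻¹) =O[atTop]
      fun t => Real.exp (-(1 / 2) * t) := by
  have hlog : (fun t : ℝ => K * ‖(Real.log t : ℂ) + c‖) =o[atTop] fun t : ℝ => t := by
    refine Asymptotics.IsLittleO.const_mul_left (Asymptotics.IsLittleO.norm_left
      (Asymptotics.IsLittleO.add ?_ ?_)) K
    · exact Asymptotics.IsLittleO.of_norm_left (by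
        simp only [norm_real]
        exact Real.isLittleO_log_id_atTop.norm_left)
    · exact Asymptotics.isLittleO_const_left.2 (Or.inr tendsto_norm_atTop_atTop)
  refine Asymptotics.IsBigO.of_bound 2 ?_
  filter_upwards [hlog.def (c := 1 / 2) (by norm_num), eventually_ge_atTop 1] with t ht ht1
  have h2 : 2 ≤ Real.exp t := by linarith [Real.add_one_le_exp t]
  have h3 : K * ‖(Real.log t : ℂ) + c‖ ≤ 1 / 2 * t := by
    refine (le_abs_self _).trans (ht.trans_eq ?_)
    rw [Real.norm_of_nonneg (by linarith)]
  have h4 : (Real.exp t - 1)⁻¹ ≤ 2 * Real.exp (-t) := by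
    rw [inv_le_comm₀ (by linarith) (by positivity), mul_inv, Real.exp_neg, inv_inv]
    linarith
  rw [Real.norm_of_nonneg (mul_nonneg (Real.exp_nonneg _) (inv_nonneg.2 (by linarith))),
    Real.norm_of_nonneg (Real.exp_nonneg _)]
  calc _ ≤ Real.exp (1 / 2 * t) * (2 * Real.exp (-t)) :=
        mul_le_mul (Real.exp_le_exp.2 h3) h4 (inv_nonneg.2 (by linarith)) (Real.exp_nonneg _)
    _ = 2 * Real.exp (-(1 / 2) * t) := by
      rw [mul_left_comm, ← Real.exp_add]
      ring_nf

theorem integrableOn_exp_log_div {r : ℝ} (hr : 0 < r) (K : ℝ) (c : ℂ) :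
    IntegrableOn (fun t : ℝ => Real.exp (K * ‖(Real.log t : ℂ) + c‖) * (Real.exp t - 1)⁻¹)
      (Set.Ioi r) := by
  refine integrable_of_isBigO_exp_neg (b := 1 / 2) (by norm_num) ?_ (isBigO_exp_log_div K c)
  refine ContinuousOn.mul ?_ (ContinuousOn.inv₀ (by fun_prop) fun t ht => ?_)
  · have : ContinuousOn Real.log (Set.Ici r) :=
      Real.continuousOn_log.mono fun t ht => (hr.trans_le ht).ne'
    fun_prop
  · have := Real.add_one_le_exp t
    have : r ≤ t := ht
    linarith

section Contour

variable {f : ℝ → ℂ} {C R r : ℝ}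

/-- Serves both edges, with `c = ∓iπ`: there `s = -t`, so the kernel is the positive real `1 / (e^t
- 1)`. -/
theorem edge_integrable_and_differentiable (hC : 0 ≤ C) (hR : 0 ≤ R) (hRr : R < r)
    (hP : ∀ n, ‖pNum f n‖ ≤ C * R ^ n) {c : ℂ} (hc : exp c = -1) :
    (∀ z, IntegrableOn (fun t : ℝ => jIntegrand f z (Real.log t + c)) (Set.Ioi r)) ∧
      Differentiable ℂ fun z => ∫ t in Set.Ioi r, jIntegrand f z (Real.log t + c) := by
  have hr : 0 < r := hR.trans_lt hRr
  have hexp : ∀ t ∈ Set.Ioi r, exp ((Real.log t : ℂ) + c) = -t := by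
    intro t ht
    rw [exp_add, hc, ← ofReal_exp, Real.exp_log (hr.trans ht), mul_neg_one]
  simp only [jIntegrand, div_eq_mul_inv]
  refine integrable_and_differentiable_integral_genPow hC hR hRr hP measurableSet_Ioi
    (by fun_prop) (by fun_prop) (fun t ht => ?_) fun K => ?_
  · rw [hexp t ht, norm_neg, norm_real]
    exact (le_of_lt ht).trans (le_abs_self t)
  · refine (integrableOn_exp_log_div hr K c).congr_fun (fun t ht => ?_) measurableSet_Ioi
    have h1 : 0 ≤ Real.exp t - 1 := by
      have : r < t := ht
      linarith [Real.add_one_le_exp t]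
    have h2 : exp (-exp ((Real.log t : ℂ) + c)) - 1 = ((Real.exp t - 1 : ℝ) : ℂ) := by
      rw [hexp t ht, neg_neg]
      push_cast
      rfl
    simp only [h2, norm_inv, norm_real, Real.norm_of_nonneg h1]

theorem circle_integrable_and_differentiable (hC : 0 ≤ C) (hR : 0 ≤ R) (hRr : R < r)
    (hP : ∀ n, ‖pNum f n‖ ≤ C * R ^ n) (hr : ∀ n : ℤ, r ≠ |(n : ℝ)| * (2 * Real.pi)) :
    (∀ z, IntervalIntegrable (fun θ : ℝ => jIntegrand f z (Real.log r + θ * I) *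
      (I * (r * exp (θ * I)))) volume (-Real.pi) Real.pi) ∧
    Differentiable ℂ fun z => ∫ θ in (-Real.pi)..Real.pi,
      jIntegrand f z (Real.log r + θ * I) * (I * (r * exp (θ * I))) := by
  have hr0 : 0 < r := hR.trans_lt hRr
  have hπ : -Real.pi ≤ Real.pi := by linarith [Real.pi_pos]
  have hexp : ∀ θ : ℝ, ‖exp ((Real.log r : ℂ) + θ * I)‖ = r := by
    intro θ
    rw [norm_exp, add_re, ofReal_re, re_ofReal_mul, I_re, mul_zero, add_zero, Real.exp_log hr0]
  -- The kernel and the factor from `ds` are grouped into a single weight `φ`.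
  simp only [jIntegrand, div_eq_mul_inv, intervalIntegral.integral_of_le hπ,
    intervalIntegrable_iff_integrableOn_Ioc_of_le hπ, mul_assoc _ _ (I * _)]
  refine integrable_and_differentiable_integral_genPow hC hR hRr hP measurableSet_Ioc
    (by fun_prop) (by fun_prop) (fun θ _ => (hexp θ).ge) fun K => ?_
  refine Continuous.integrableOn_Ioc ?_
  have hinv : Continuous fun θ : ℝ => (exp (-exp ((Real.log r : ℂ) + θ * I)) - 1)⁻¹ :=
    Continuous.inv₀ (by fun_prop) fun θ =>
      exp_neg_exp_sub_one_ne_zero fun n => (hexp θ).trans_ne (hr n)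
  fun_prop

end Contour

/-- The reciprocal of `Γ` is entire, and its value at `1 - z` is nonzero away from the poles. -/
theorem analyticAt_Gamma_one_sub {z : ℂ} (hz : ∀ n : ℕ, 1 ≤ n → z ≠ n) :
    AnalyticAt ℂ (fun z => Gamma (1 - z)) z := by
  have hd : Differentiable ℂ fun z : ℂ => (Gamma (1 - z))⁻¹ :=
    differentiable_one_div_Gamma.comp (differentiable_id.const_sub 1)
  have hne : (Gamma (1 - z))⁻¹ ≠ 0 := inv_ne_zero (Gamma_ne_zero fun m hm => by
    refine hz (m + 1) (by omega) ?_
    push_cast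
    linear_combination -hm)
  simpa only [inv_inv] using (hd.analyticAt z).fun_inv hne

end LCFunctions

theorem theorem5p6 (f : ℝ → ℂ) (hf : AnalyticAt ℝ f 0) (hρ : 0 < LCFunctions.rho f)
    (m : ℤ) (hm : IsLeast {k : ℤ | LCFunctions.rad f < 2 * (k : ℝ) * Real.pi} m)
    (r : ℝ) (hr : LCFunctions.rad f < r) (hr' : r < 2 * (m : ℝ) * Real.pi) :
    (∀ z w : ℂ, LCFunctions.rad f < ‖Complex.exp w‖ →
      Summable (LCFunctions.genPowTerm (LCFunctions.under f) w z)) ∧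
    (∀ z : ℂ, LCFunctions.HankelIntegrable r
      (LCFunctions.jIntegrand (LCFunctions.under f) z)) ∧
    Differentiable ℂ (fun z : ℂ => LCFunctions.J r (LCFunctions.under f) z) ∧
    AnalyticOnNhd ℂ (fun z : ℂ => LCFunctions.F r f z)
      {z : ℂ | ∀ n : ℕ, 1 ≤ n → z ≠ (n : ℂ)} := by
  open LCFunctions Complex in
  have hbound : ∀ {R : ℝ}, rad f < R →
      ∃ C, 0 ≤ C ∧ ∀ n, ‖pNum (under f) n‖ ≤ C * R ^ n := by
    intro R hR
    simpa only [norm_pNum_under] using exists_norm_pNum_le hρ hR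
  obtain ⟨R, hR, hRr⟩ := exists_between hr
  have hR0 : 0 ≤ R := (rad_nonneg f).trans hR.le
  obtain ⟨C, hC, hP⟩ := hbound hR
  have hlower := edge_integrable_and_differentiable hC hR0 hRr hP
    (c := -(Real.pi * I)) (by rw [exp_neg, exp_pi_mul_I]; norm_num)
  have hupper := edge_integrable_and_differentiable hC hR0 hRr hP exp_pi_mul_I
  have hcircle := circle_integrable_and_differentiable hC hR0 hRr hP
    (ne_abs_mul_two_pi hm hr hr')
  simp only [← sub_eq_add_neg] at hlower
  have hJ : Differentiable ℂ (fun z : ℂ => J r (under f) z) :=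
    ((hlower.2.add hcircle.2).sub hupper.2).const_mul _
  refine ⟨fun z w hw => ?_, fun z => ⟨hlower.1 z, hcircle.1 z, hupper.1 z⟩, hJ, fun z hz => ?_⟩
  -- A new radius is needed: `|s|` only exceeds `r_f` and may be smaller than `R`.
  · obtain ⟨R', hR', hRw⟩ := exists_between hw
    obtain ⟨C', hC', hP'⟩ := hbound hR'
    exact summable_genPowTerm hC' ((rad_nonneg f).trans hR'.le) hP' z hRw
  · exact (analyticAt_Gamma_one_sub hz).mul (hJ.analyticAt z)
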